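/- For a prime $p$, a set $A\subseteq\mathbb F_p$ and $k\ge 1$, let $$E_k^\times(A)=\#\{(a_1,\dots,a_k,a_1',\dots,a_k')\in A^{2k}:\ a_1\cdots a_k=a_1'\cdots a_k'\}$$ be the $k$-fold multiplicative energy of $A$, and put $\eta(A)=\frac{\log|A|}{\log p}$ and $\mu(A)=\frac{\log E_3^\times(A)}{\log|A|}$. Let $\mathcal H_p=\{(\eta(A),\mu(A)):A\subseteq\mathbb F_p\}$ (sets with $|A|\le 1$ play no role below), let $$R=\{(x,y):\ 1/3<x<3/8,\ 113/24<y<5\},\qquad U_p=R\cap\mathcal H_p .$$ Then, as $p\to\infty$ through the primes: 1. For every point of $U_p$ there is a set $A\subseteq\mathbb F_p^*$ belonging to it for which $E_4^\times(A)/(|A|E_3^\times(A))\to\infty$, uniformly over $U_p$. Precisely: for all real $M$ and $\varepsilon>0$ there is $p_0$ such that for every prime $p\ge p_0$ and every $(x,y)\in U_p$ there is a set $A\subseteq\mathbb F_p^*$ with $$\eta(A)=x,\qquad |\mu(A)-y|<\varepsilon,\qquad \frac{E_4^\times(A)}{|A|\,E_3^\times(A)}>M,$$ and moreover $\mu(A)=y$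 exactly whenever $(x,y)=(\eta(B),\mu(B))$ for some $B\subseteq\mathbb F_p^*$. 2. Every point of $R$ is reached asymptotically: for every $(x,y)\in R$ there are sets $A_p\subseteq\mathbb F_p^*$, one for each prime $p$, such that $$\lim_{p\to\infty}\eta(A_p)=x,\qquad \lim_{p\to\infty}\mu(A_p)=y,\qquad \lim_{p\to\infty}\frac{E_4^\times(A_p)}{|A_p|\,E_3^\times(A_p)}=\infty .$$ -/

import Mathlib

namespace EnergyDist

open Filter

/-- The `k`-fold multiplicative energy of `A`: the number of `2k`-tuples
`(a₁, …, aₖ, a₁', …, aₖ')` of elements of `A` with `a₁ ⋯ aₖ = a₁' ⋯ aₖ'`. -/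
def energy (k : ℕ) {p : ℕ} (A : Finset (ZMod p)) : ℕ :=
  (((Fintype.piFinset fun _ : Fin k => A) ×ˢ (Fintype.piFinset fun _ : Fin k => A)).filter
    fun t => ∏ i, t.1 i = ∏ i, t.2 i).card

/-- `η(A) = log |A| / log p`. -/
noncomputable def eta {p : ℕ} (A : Finset (ZMod p)) : ℝ :=
  Real.log A.card / Real.log p

/-- `μ(A) = log E₃(A) / log |A|`. -/
noncomputable def mu {p : ℕ} (A : Finset (ZMod p)) : ℝ :=
  Real.log (energy 3 A) / Real.log A.card

/-- The ratio `E₄(A) / (|A| E₃(A))`. -/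
noncomputable def ratio {p : ℕ} (A : Finset (ZMod p)) : ℝ :=
  (energy 4 A : ℝ) / ((A.card : ℝ) * (energy 3 A : ℝ))

/-- The set `H_p` of all pairs `(η(A), μ(A))` with `A ⊆ F_p`. -/
def H (p : ℕ) : Set (ℝ × ℝ) :=
  {z | ∃ A : Finset (ZMod p), z = (eta A, mu A)}

/-- The pairs `(η(A), μ(A))` that are attained by some `A ⊆ F_p \ {0}`. -/
def HStar (p : ℕ) : Set (ℝ × ℝ) :=
  {z | ∃ A : Finset (ZMod p), 0 ∉ A ∧ z = (eta A, mu A)}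

/-- The open rectangle `1/3 < x < 3/8`, `113/24 < y < 5`. -/
def rect : Set (ℝ × ℝ) :=
  {z | 1 / 3 < z.1 ∧ z.1 < 3 / 8 ∧ 113 / 24 < z.2 ∧ z.2 < 5}

/-- The region `U`, which depends on `p` through `H_p`. -/
def U (p : ℕ) : Set (ℝ × ℝ) := rect ∩ H p

/-- The filter `p → ∞` along the primes. -/
def primesAtTop : Filter ℕ := atTop ⊓ 𝓟 {p | p.Prime}

end EnergyDist

/-!
The condition `μ(A) > 113/24` says that the threefold energy is much larger than `|A|⁴`, and this
alone forces `E₄(A) / (|A| E₃(A))` to be large. Indeed, for `0 ∉ A`, splitting off one factor on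
each side of `a₁a₂a₃ = a₁'a₂'a₃'` and applying Cauchy–Schwarz over the pair `(a₁, a₁')` gives
`E₃(A)² ≤ |A|³ E₄(A)` (`energy_three_sq_le`), so the ratio is at least
`E₃(A) / |A|⁴ = |A| ^ (μ(A) - 4)` (`div_le_ratio`).

For the uniform assertion, a set realising the point serves if it avoids `0`. If only sets
containing `0` realise it, replace `0` by a nonzero element outside the set: the cardinality is
unchanged and `E₃` moves by at most `9|A|⁴`, which is negligible
(`exists_notMem_energy_near`).

For the density assertion, transport exponents through a primitive root `g`. The exponents are the
sums of an element of an interval of length `L` and a multiple of a base-expansion encoding of a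
point `(k, k², k³)`, `k < m`. Three such exponents add up without carries or reduction modulo
`p - 1`, and a triple is determined up to order by its first three power sums, so that the energy
`E₃` has the order of magnitude `L⁵ m³` (`energy_three_curveSet_le`, `le_energy_three_curveSet`)
while the set has `L m` elements. With `L = ⌊p ^ (x (1 - b))⌋`, `m = ⌊p ^ (x b)⌋` and
`b = (5 - y) / 2` this yields `η → x` and `μ → 5 (1 - b) + 3 b = y`; the exponents fit because
`x (1 + 5 b) < 1` on the rectangle.
-/

namespace EnergyDist

open Filter Finset Topology

/-! ### Energies: monotonicity, Cauchy–Schwarz, and changing one element -/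

section

variable {p : ℕ}

/-- The pairs of `k`-tuples counted by `energy k A`. -/
def solutions (k : ℕ) (A : Finset (ZMod p)) : Finset ((Fin k → ZMod p) × (Fin k → ZMod p)) :=
  ((Fintype.piFinset fun _ : Fin k => A) ×ˢ (Fintype.piFinset fun _ : Fin k => A)).filter
    fun t => ∏ i, t.1 i = ∏ i, t.2 i

theorem card_solutions (k : ℕ) (A : Finset (ZMod p)) : (solutions k A).card = energy k A := rfl

theorem mem_solutions {k : ℕ} {A : Finset (ZMod p)} {t : (Fin k → ZMod p) × (Fin k → ZMod p)} :
    t ∈ solutions k A ↔ ((∀ i, t.1 i ∈ A) ∧ ∀ i, t.2 i ∈ A) ∧ ∏ i, t.1 i = ∏ i, t.2 i := by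
  simp [solutions]

theorem energy_mono (k : ℕ) {A B : Finset (ZMod p)} (h : A ⊆ B) : energy k A ≤ energy k B := by
  rw [← card_solutions, ← card_solutions]
  refine card_le_card fun t ht => ?_
  rw [mem_solutions] at ht ⊢
  exact ⟨⟨fun i => h (ht.1.1 i), fun i => h (ht.1.2 i)⟩, ht.2⟩

/-- Cauchy–Schwarz over the fibres of the product map: few distinct `k`-fold products force a large
energy. -/
theorem sq_card_pow_le_card_image_mul_energy (k : ℕ) (A : Finset (ZMod p)) :
    (A.card ^ k) ^ 2 ≤
      ((Fintype.piFinset fun _ : Fin k => A).image fun u => ∏ i, u i).card * energy k A := by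
  set T := Fintype.piFinset fun _ : Fin k => A with hT
  set P := T.image fun u => ∏ i, u i with hP
  have h1 : T.card = ∑ z ∈ P, (T.filter fun u => ∏ i, u i = z).card :=
    card_eq_sum_card_image _ _
  have h2 : energy k A = ∑ z ∈ P, (T.filter fun u => ∏ i, u i = z).card ^ 2 := by
    rw [← card_solutions, card_eq_sum_card_fiberwise (f := fun t => ∏ i, t.1 i) (t := P)]
    · refine sum_congr rfl fun z _ => ?_
      rw [sq, ← card_product]
      congr 1
      ext t
      simp only [mem_filter, mem_product, solutions, ← hT]
      constructor
      · rintro ⟨⟨⟨h, h'⟩, e⟩, rfl⟩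
        exact ⟨⟨h, rfl⟩, h', e.symm⟩
      · rintro ⟨⟨h, rfl⟩, h', e⟩
        exact ⟨⟨⟨h, h'⟩, e.symm⟩, rfl⟩
    · intro t ht
      have ht' : t ∈ solutions k A := ht
      rw [solutions, mem_filter, mem_product] at ht'
      exact mem_image_of_mem _ ht'.1.1
  have h3 : T.card = A.card ^ k := by simp [hT]
  rw [← h3, h1, h2]
  exact sq_sum_le_card_mul_sum_sq

/-- A family of solutions in which one coordinate on each side is determined by the other four has
at most `|A|⁴` members. -/
theorem card_le_of_injOn_removeNth {A : Finset (ZMod p)}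
    {W : Finset ((Fin 3 → ZMod p) × (Fin 3 → ZMod p))} (hW : W ⊆ solutions 3 A) (i j : Fin 3)
    (hinj : Set.InjOn (fun t : (Fin 3 → ZMod p) × (Fin 3 → ZMod p) =>
      ((i.removeNth t.1 : Fin 2 → ZMod p), (j.removeNth t.2 : Fin 2 → ZMod p))) W) :
    W.card ≤ A.card ^ 4 := by
  have : A.card ^ 4 = ((Fintype.piFinset fun _ : Fin 2 => A) ×ˢ
      (Fintype.piFinset fun _ : Fin 2 => A)).card := by
    simp [card_product]; ring
  rw [this]
  refine card_le_card_of_injOn _ (fun t ht => ?_) hinj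
  have := mem_solutions.1 (hW ht)
  simp only [coe_product, Set.mem_prod, mem_coe, Fintype.mem_piFinset, Fin.removeNth]
  exact ⟨fun _ => this.1.1 _, fun _ => this.1.2 _⟩

theorem eq_of_removeNth_eq {u v : Fin 3 → ZMod p} (i : Fin 3) (hi : u i = v i)
    (h : (i.removeNth u : Fin 2 → ZMod p) = i.removeNth v) : u = v := by
  rw [← Fin.insertNth_self_removeNth i u, ← Fin.insertNth_self_removeNth i v, hi, h]

variable [Fact p.Prime]

theorem eq_of_removeNth_eq_of_prod_eq {u v : Fin 3 → ZMod p} (i : Fin 3) (h0 : ∀ j, u j ≠ 0)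
    (hp : ∏ j, u j = ∏ j, v j)
    (h : (i.removeNth u : Fin 2 → ZMod p) = i.removeNth v) : u = v := by
  refine eq_of_removeNth_eq i ?_ h
  have h' : ∀ j, u (i.succAbove j) = v (i.succAbove j) := fun j => congrFun h j
  rw [Fin.prod_univ_succAbove _ i, Fin.prod_univ_succAbove _ i] at hp
  simp only [← h'] at hp
  exact mul_right_cancel₀ (prod_ne_zero_iff.2 fun j _ => h0 _) hp

/-- A new solution has a `0` on both sides, and these two coordinates can be removed. -/
theorem energy_three_insert_zero_le {S : Finset (ZMod p)} (hS : (0 : ZMod p) ∉ S) :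
    energy 3 (insert 0 S) ≤ energy 3 S + 9 * (S.card + 1) ^ 4 := by
  let W : Fin 3 × Fin 3 → Finset ((Fin 3 → ZMod p) × (Fin 3 → ZMod p)) := fun ij =>
    (solutions 3 (insert 0 S)).filter fun t => t.1 ij.1 = 0 ∧ t.2 ij.2 = 0
  have hsub : solutions 3 (insert 0 S) ⊆ solutions 3 S ∪ univ.biUnion W := by
    intro t ht
    have h := mem_solutions.1 ht
    rw [mem_union, mem_biUnion]
    by_cases h0 : ∏ i, t.1 i = 0
    · right
      obtain ⟨i, -, hi⟩ := prod_eq_zero_iff.1 h0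
      obtain ⟨j, -, hj⟩ := prod_eq_zero_iff.1 (h.2 ▸ h0)
      exact ⟨(i, j), mem_univ _, mem_filter.2 ⟨ht, hi, hj⟩⟩
    · left
      have h0' : ∏ i, t.2 i ≠ 0 := h.2 ▸ h0
      refine mem_solutions.2 ⟨⟨fun i => ?_, fun i => ?_⟩, h.2⟩
      · exact (mem_insert.1 (h.1.1 i)).resolve_left (prod_ne_zero_iff.1 h0 i (mem_univ _))
      · exact (mem_insert.1 (h.1.2 i)).resolve_left (prod_ne_zero_iff.1 h0' i (mem_univ _))
  have hW : ∀ ij, (W ij).card ≤ (S.card + 1) ^ 4 := by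
    intro ij
    rw [← card_insert_of_notMem hS]
    refine card_le_of_injOn_removeNth (filter_subset _ _) ij.1 ij.2 ?_
    intro t ht t' ht' h
    have h1 := mem_filter.1 (mem_coe.1 ht)
    have h2 := mem_filter.1 (mem_coe.1 ht')
    obtain ⟨e1, e2⟩ := Prod.mk.inj h
    exact Prod.ext (eq_of_removeNth_eq _ (h1.2.1.trans h2.2.1.symm) e1)
      (eq_of_removeNth_eq _ (h1.2.2.trans h2.2.2.symm) e2)
  rw [← card_solutions, ← card_solutions]
  calc _ ≤ _ := card_le_card hsub
    _ ≤ _ := card_union_le _ _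
    _ ≤ _ := by
      gcongr
      refine card_biUnion_le.trans ((sum_le_card_nsmul _ _ _ fun ij _ => hW ij).trans ?_)
      simp

/-- A new solution has a coordinate equal to `c`; the equation then determines a coordinate on the
other side. -/
theorem energy_three_insert_le {S : Finset (ZMod p)} (hS : (0 : ZMod p) ∉ S) {c : ZMod p}
    (hc : c ≠ 0) (hcS : c ∉ S) :
    energy 3 (insert c S) ≤ energy 3 S + 6 * (S.card + 1) ^ 4 := by
  have hA : (0 : ZMod p) ∉ insert c S := by simp [hS, hc.symm]
  have hne : ∀ a ∈ insert c S, a ≠ 0 := fun a ha h => hA (h ▸ ha)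
  let V : Fin 3 → Finset ((Fin 3 → ZMod p) × (Fin 3 → ZMod p)) := fun i =>
    (solutions 3 (insert c S)).filter fun t => t.1 i = c
  let W : Fin 3 → Finset ((Fin 3 → ZMod p) × (Fin 3 → ZMod p)) := fun i =>
    (solutions 3 (insert c S)).filter fun t => t.2 i = c
  have hsub : solutions 3 (insert c S) ⊆
      solutions 3 S ∪ (univ.biUnion V ∪ univ.biUnion W) := by
    intro t ht
    have h := mem_solutions.1 ht
    simp only [mem_union, mem_biUnion, mem_univ, true_and]
    by_cases h1 : ∃ i, t.1 i = c
    · exact Or.inr (Or.inl (h1.imp fun i hi => mem_filter.2 ⟨ht, hi⟩))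
    by_cases h2 : ∃ i, t.2 i = c
    · exact Or.inr (Or.inr (h2.imp fun i hi => mem_filter.2 ⟨ht, hi⟩))
    push Not at h1 h2
    exact Or.inl (mem_solutions.2 ⟨⟨fun i => (mem_insert.1 (h.1.1 i)).resolve_left (h1 i),
      fun i => (mem_insert.1 (h.1.2 i)).resolve_left (h2 i)⟩, h.2⟩)
  have hV : ∀ i, (V i).card ≤ (S.card + 1) ^ 4 := by
    intro i
    rw [← card_insert_of_notMem hcS]
    refine card_le_of_injOn_removeNth (filter_subset _ _) i 0 ?_
    intro t ht t' ht' h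
    have h1 := mem_filter.1 (mem_coe.1 ht)
    have h2 := mem_filter.1 (mem_coe.1 ht')
    have m1 := mem_solutions.1 h1.1
    have m2 := mem_solutions.1 h2.1
    obtain ⟨e1, e2⟩ := Prod.mk.inj h
    have e3 := eq_of_removeNth_eq _ (h1.2.trans h2.2.symm) e1
    refine Prod.ext e3 (eq_of_removeNth_eq_of_prod_eq 0 (fun j => hne _ (m1.1.2 j)) ?_ e2)
    rw [← m1.2, ← m2.2, e3]
  have hW : ∀ i, (W i).card ≤ (S.card + 1) ^ 4 := by
    intro i
    rw [← card_insert_of_notMem hcS]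
    refine card_le_of_injOn_removeNth (filter_subset _ _) 0 i ?_
    intro t ht t' ht' h
    have h1 := mem_filter.1 (mem_coe.1 ht)
    have h2 := mem_filter.1 (mem_coe.1 ht')
    have m1 := mem_solutions.1 h1.1
    have m2 := mem_solutions.1 h2.1
    obtain ⟨e1, e2⟩ := Prod.mk.inj h
    have e3 := eq_of_removeNth_eq _ (h1.2.trans h2.2.symm) e2
    refine Prod.ext (eq_of_removeNth_eq_of_prod_eq 0 (fun j => hne _ (m1.1.1 j)) ?_ e1) e3
    rw [m1.2, m2.2, e3]
  have hVs := card_biUnion_le.trans (sum_le_card_nsmul (univ : Finset (Fin 3)) _ _ fun i _ => hV i)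
  have hWs := card_biUnion_le.trans (sum_le_card_nsmul (univ : Finset (Fin 3)) _ _ fun i _ => hW i)
  simp only [card_univ, Fintype.card_fin, smul_eq_mul] at hVs hWs
  have h1 := card_le_card hsub
  have h2 := card_union_le (solutions 3 S) (univ.biUnion V ∪ univ.biUnion W)
  have h3 := card_union_le (univ.biUnion V) (univ.biUnion W)
  rw [← card_solutions, ← card_solutions]
  omega

/-- Cauchy–Schwarz with `d = (a, a')` as the outer variable. A pair of solutions of
`a ∏ u = a' ∏ v` with the same `d` gives a solution of the equation counted by `E₄`, and together
with `a` it can be recovered from that solution. -/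
theorem energy_three_sq_le {A : Finset (ZMod p)} (hA : (0 : ZMod p) ∉ A) :
    energy 3 A ^ 2 ≤ A.card ^ 3 * energy 4 A := by
  have hne : ∀ a ∈ A, a ≠ 0 := fun a ha h => hA (h ▸ ha)
  set T := Fintype.piFinset fun _ : Fin 2 => A with hT
  let F : ZMod p × ZMod p → Finset ((Fin 2 → ZMod p) × (Fin 2 → ZMod p)) := fun d =>
    (T ×ˢ T).filter fun w => d.1 * ∏ i, w.1 i = d.2 * ∏ i, w.2 i
  have h1 : energy 3 A ≤ ∑ d ∈ A ×ˢ A, (F d).card := by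
    rw [← card_solutions, ← card_sigma]
    refine card_le_card_of_injOn (fun t => ⟨(t.1 0, t.2 0), (Fin.tail t.1, Fin.tail t.2)⟩) ?_ ?_
    · intro t ht
      have h := mem_solutions.1 (mem_coe.1 ht)
      simp only [coe_sigma, Set.mem_sigma_iff, mem_coe, mem_product, F, mem_filter, hT,
        Fintype.mem_piFinset, Fin.tail]
      refine ⟨⟨h.1.1 0, h.1.2 0⟩, ⟨fun i => h.1.1 _, fun i => h.1.2 _⟩, ?_⟩
      rw [← Fin.prod_univ_succ, ← Fin.prod_univ_succ]
      exact h.2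
    · intro t _ t' _ h
      simp only [Sigma.mk.injEq, Prod.mk.injEq, heq_eq_eq] at h
      refine Prod.ext ?_ ?_
      · rw [← Fin.cons_self_tail t.1, ← Fin.cons_self_tail t'.1, h.1.1, h.2.1]
      · rw [← Fin.cons_self_tail t.2, ← Fin.cons_self_tail t'.2, h.1.2, h.2.2]
  have h2 : ∑ d ∈ A ×ˢ A, (F d).card ^ 2 ≤ A.card * energy 4 A := by
    have : ∑ d ∈ A ×ˢ A, (F d).card ^ 2 = ((A ×ˢ A).sigma fun d => F d ×ˢ F d).card := by
      rw [card_sigma]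
      exact sum_congr rfl fun d _ => by rw [card_product, sq]
    rw [this, ← card_solutions, ← card_product]
    refine card_le_card_of_injOn
      (fun z => (z.1.1, (![z.2.1.1 0, z.2.1.1 1, z.2.2.2 0, z.2.2.2 1],
        ![z.2.1.2 0, z.2.1.2 1, z.2.2.1 0, z.2.2.1 1]))) ?_ ?_
    · rintro ⟨⟨a, b⟩, ⟨u, v⟩, u', v'⟩ hz
      simp only [coe_sigma, Set.mem_sigma_iff, mem_coe, mem_product, F, mem_filter, hT,
        Fintype.mem_piFinset] at hz
      obtain ⟨⟨ha, hb⟩, ⟨⟨hu, hv⟩, e⟩, ⟨hu', hv'⟩, e'⟩ := hz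
      simp only [coe_product, Set.mem_prod, mem_coe]
      refine ⟨ha, mem_solutions.2 ⟨⟨?_, ?_⟩, ?_⟩⟩
      · simp [Fin.forall_fin_succ, hu, hv']
      · simp [Fin.forall_fin_succ, hv, hu']
      · have hab : a * b ≠ 0 := mul_ne_zero (hne a ha) (hne b hb)
        simp only [Fin.prod_univ_two] at e e'
        simp only [Fin.prod_univ_four, Matrix.cons_val]
        refine mul_left_cancel₀ hab ?_
        linear_combination (b * (v' 0 * v' 1)) * e - (b * (v 0 * v 1)) * e'
    · rintro ⟨⟨a, b⟩, ⟨u, v⟩, u', v'⟩ hz ⟨⟨a₁, b₁⟩, ⟨u₁, v₁⟩, u₁', v₁'⟩ hz₁ h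
      simp only [coe_sigma, Set.mem_sigma_iff, mem_coe, mem_product, F, mem_filter, hT,
        Fintype.mem_piFinset] at hz hz₁
      have hext : ∀ {f g : Fin 2 → ZMod p}, f 0 = g 0 → f 1 = g 1 → f = g := fun h0 h1 =>
        funext (Fin.forall_fin_two.2 ⟨h0, h1⟩)
      simp only [Prod.mk.injEq, Matrix.vecCons_inj, and_true] at h
      obtain ⟨rfl, ⟨hu0, hu1, hw0, hw1⟩, hv0, hv1, hx0, hx1⟩ := h
      obtain rfl := hext hu0 hu1
      obtain rfl := hext hv0 hv1
      obtain rfl := hext hw0 hw1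
      obtain rfl := hext hx0 hx1
      have hv0 : ∏ i, v i ≠ 0 := prod_ne_zero_iff.2 fun i _ => hne _ (hz.2.1.1.2 i)
      have : b = b₁ := mul_right_cancel₀ hv0 (hz.2.1.2.symm.trans hz₁.2.1.2)
      rw [this]
  calc energy 3 A ^ 2 ≤ (∑ d ∈ A ×ˢ A, (F d).card) ^ 2 := Nat.pow_le_pow_left h1 2
    _ ≤ (A ×ˢ A).card * ∑ d ∈ A ×ˢ A, (F d).card ^ 2 := sq_sum_le_card_mul_sum_sq
    _ ≤ (A ×ˢ A).card * (A.card * energy 4 A) := Nat.mul_le_mul_left _ h2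
    _ = A.card ^ 3 * energy 4 A := by rw [card_product]; ring

end

/-! ### Sets whose threefold energy is prescribed up to a constant -/

section

/-- Three numbers are determined up to order by their first three power sums: by Newton's identities
`a'` is a root of `(X - a)(X - b)(X - c)`. -/
theorem eq_or_of_power_sums_eq {a b c a' b' c' : ℕ} (h1 : a + b + c = a' + b' + c')
    (h2 : a ^ 2 + b ^ 2 + c ^ 2 = a' ^ 2 + b' ^ 2 + c' ^ 2)
    (h3 : a ^ 3 + b ^ 3 + c ^ 3 = a' ^ 3 + b' ^ 3 + c' ^ 3) : a' = a ∨ a' = b ∨ a' = c := by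
  zify at h1 h2 h3
  have hc : (c' : ℤ) = a + b + c - a' - b' := by linarith
  have key : 6 * (((a' : ℤ) - a) * ((a' - b) * (a' - c))) = 0 := by
    rw [hc] at h2 h3
    grind
  have h := (mul_eq_zero.1 key).resolve_left (by norm_num)
  rcases mul_eq_zero.1 h with h | h
  · left; omega
  rcases mul_eq_zero.1 h with h | h
  · right; left; omega
  · right; right; omega

/-- The number with mixed-radix digits `a, b, c, d`. The radices `3L`, `3m`, `3m²` leave room for
the sum of three admissible digits in each place. -/
def code (L m a b c d : ℕ) : ℕ := a + 3 * L * (b + 3 * m * (c + 3 * m ^ 2 * d))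

theorem eq_and_eq_of_add_mul_eq {N a a' b b' : ℕ} (ha : a < N) (ha' : a' < N)
    (h : a + N * b = a' + N * b') : a = a' ∧ b = b' := by
  have h1 := congrArg (· % N) h
  simp only [Nat.add_mul_mod_self_left, Nat.mod_eq_of_lt ha, Nat.mod_eq_of_lt ha'] at h1
  subst h1
  exact ⟨rfl, Nat.eq_of_mul_eq_mul_left (by omega) (Nat.add_left_cancel h)⟩

theorem code_inj {L m a b c d a' b' c' d' : ℕ} (ha : a < 3 * L) (ha' : a' < 3 * L)
    (hb : b < 3 * m) (hb' : b' < 3 * m) (hc : c < 3 * m ^ 2) (hc' : c' < 3 * m ^ 2)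
    (h : code L m a b c d = code L m a' b' c' d') : a = a' ∧ b = b' ∧ c = c' ∧ d = d' := by
  obtain ⟨h1, h⟩ := eq_and_eq_of_add_mul_eq ha ha' h
  obtain ⟨h2, h⟩ := eq_and_eq_of_add_mul_eq hb hb' h
  exact ⟨h1, h2, eq_and_eq_of_add_mul_eq hc hc' h⟩

/-- For `v = (i, k)`, the code of `(i, k, k², k³)`: an interval variable `i` and a point of the
moment curve. -/
def curveCode (L m : ℕ) (v : ℕ × ℕ) : ℕ := code L m v.1 v.2 (v.2 ^ 2) (v.2 ^ 3)

theorem sum_curveCode (L m : ℕ) (s : Fin 3 → ℕ × ℕ) :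
    ∑ j, curveCode L m (s j) =
      code L m (∑ j, (s j).1) (∑ j, (s j).2) (∑ j, (s j).2 ^ 2) (∑ j, (s j).2 ^ 3) := by
  simp only [Fin.sum_univ_three, curveCode, code]
  ring

theorem three_mul_curveCode_lt {L m : ℕ} {v : ℕ × ℕ} (hv : v ∈ range L ×ˢ range m) :
    3 * curveCode L m v < 120 * (L * m ^ 6) := by
  obtain ⟨hi, hk⟩ := mem_product.1 hv
  have hi := mem_range.1 hi
  have hk := mem_range.1 hk
  have hm : 1 ≤ m := by omega
  have h1 : v.2 ≤ m ^ 6 := hk.le.trans (Nat.le_self_pow (by norm_num) m)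
  have h2 : m * v.2 ^ 2 ≤ m ^ 6 := calc
    m * v.2 ^ 2 ≤ m * m ^ 2 := by gcongr
    _ = m ^ 3 := by ring
    _ ≤ m ^ 6 := Nat.pow_le_pow_right hm (by norm_num)
  have h3 : m ^ 3 * v.2 ^ 3 ≤ m ^ 6 := calc
    m ^ 3 * v.2 ^ 3 ≤ m ^ 3 * m ^ 3 := by gcongr
    _ = m ^ 6 := by ring
  have h4 : L ≤ L * m ^ 6 := Nat.le_mul_of_pos_right _ (by positivity)
  have h5 : L * (3 * v.2 + 9 * (m * v.2 ^ 2) + 27 * (m ^ 3 * v.2 ^ 3)) ≤ L * (39 * m ^ 6) :=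
    Nat.mul_le_mul_left _ (by omega)
  have h6 : curveCode L m v =
      v.1 + L * (3 * v.2 + 9 * (m * v.2 ^ 2) + 27 * (m ^ 3 * v.2 ^ 3)) := by
    simp only [curveCode, code]; ring
  have h7 : L * (39 * m ^ 6) = 39 * (L * m ^ 6) := by ring
  omega

theorem sum_fst_lt {L m : ℕ} {s : Fin 3 → ℕ × ℕ} (hs : ∀ j, s j ∈ range L ×ˢ range m) :
    ∑ j, (s j).1 < 3 * L := by
  have h := fun j => mem_range.1 (mem_product.1 (hs j)).1
  have := h 0; have := h 1; have := h 2
  rw [Fin.sum_univ_three]; omega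

theorem sum_snd_pow_lt {L m r : ℕ} (hr : r ≠ 0) {s : Fin 3 → ℕ × ℕ}
    (hs : ∀ j, s j ∈ range L ×ˢ range m) : ∑ j, (s j).2 ^ r < 3 * m ^ r := by
  have h := fun j => Nat.pow_lt_pow_left (mem_range.1 (mem_product.1 (hs j)).2) hr
  have := h 0; have := h 1; have := h 2
  rw [Fin.sum_univ_three]; omega

/-- Equality of threefold sums of codes forces the interval parts to have equal sums and each curve
parameter on the right to occur on the left. -/
theorem sum_curveCode_eq {L m : ℕ} {s s' : Fin 3 → ℕ × ℕ}
    (hs : ∀ j, s j ∈ range L ×ˢ range m) (hs' : ∀ j, s' j ∈ range L ×ˢ range m)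
    (h : ∑ j, curveCode L m (s j) = ∑ j, curveCode L m (s' j)) :
    ∑ j, (s j).1 = ∑ j, (s' j).1 ∧ ∀ j, ∃ i, (s' j).2 = (s i).2 := by
  rw [sum_curveCode, sum_curveCode] at h
  obtain ⟨h0, h1, h2, h3⟩ := code_inj (sum_fst_lt hs) (sum_fst_lt hs')
    (by simpa using sum_snd_pow_lt one_ne_zero hs) (by simpa using sum_snd_pow_lt one_ne_zero hs')
    (sum_snd_pow_lt two_ne_zero hs) (sum_snd_pow_lt two_ne_zero hs') h
  refine ⟨h0, ?_⟩
  simp only [Fin.sum_univ_three] at h1 h2 h3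
  rw [Fin.forall_fin_succ, Fin.forall_fin_two]
  simp only [Fin.exists_fin_succ]
  refine ⟨?_, ?_, ?_⟩
  · simpa using eq_or_of_power_sums_eq h1 h2 h3
  · simpa using eq_or_of_power_sums_eq (a' := (s' 1).2) (b' := (s' 0).2) (c' := (s' 2).2)
      (by omega) (by omega) (by omega)
  · simpa using eq_or_of_power_sums_eq (a' := (s' 2).2) (b' := (s' 0).2) (c' := (s' 1).2)
      (by omega) (by omega) (by omega)

variable {p : ℕ}

/-- The powers of `g` whose exponents are the codes of `(i, k)` with `i < L` and `k < m`. -/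
def curveSet (g : ZMod p) (L m : ℕ) : Finset (ZMod p) :=
  (range L ×ˢ range m).image fun v => g ^ curveCode L m v

variable [Fact p.Prime]

theorem zero_notMem_curveSet {g : ZMod p} (hg : g ≠ 0) (L m : ℕ) : 0 ∉ curveSet g L m := by
  simp [curveSet, hg]

/-- A primitive root, in the form in which it is used. -/
theorem exists_injOn_pow :
    ∃ g : ZMod p, g ≠ 0 ∧ Set.InjOn (fun n : ℕ => g ^ n) (Set.Iio (p - 1)) := by
  obtain ⟨g, hg⟩ := IsCyclic.exists_generator (α := (ZMod p)ˣ)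
  have ho : orderOf g = p - 1 := by
    rw [orderOf_eq_card_of_forall_mem_zpowers hg, Nat.card_eq_fintype_card, ZMod.card_units]
  refine ⟨g, g.ne_zero, fun a ha b hb h => ?_⟩
  rw [← ho] at ha hb
  exact pow_injOn_Iio_orderOf ha hb (Units.ext (by simpa using h))

theorem card_curveSet {g : ZMod p} {L m : ℕ}
    (hg : Set.InjOn (fun n : ℕ => g ^ n) (Set.Iio (p - 1))) (hp : 120 * (L * m ^ 6) < p) :
    (curveSet g L m).card = L * m := by
  rw [curveSet, card_image_of_injOn, card_product, card_range, card_range]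
  intro v hv w hw h
  have h1 := three_mul_curveCode_lt (mem_coe.1 hv)
  have h2 := three_mul_curveCode_lt (mem_coe.1 hw)
  have h3 : curveCode L m v = curveCode L m w :=
    hg (Set.mem_Iio.2 (by omega)) (Set.mem_Iio.2 (by omega)) h
  have hv := mem_product.1 (mem_coe.1 hv)
  have hw := mem_product.1 (mem_coe.1 hw)
  simp only [mem_range] at hv hw
  obtain ⟨h0, h1, -⟩ := code_inj (by omega) (by omega) (by omega) (by omega)
    ((Nat.pow_lt_pow_left hv.2 two_ne_zero).trans_le (Nat.le_mul_of_pos_left _ (by norm_num)))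
    ((Nat.pow_lt_pow_left hw.2 two_ne_zero).trans_le (Nat.le_mul_of_pos_left _ (by norm_num))) h3
  exact Prod.ext h0 h1

/-- A solution is determined by the three pairs on the left, two interval parts on the right (the
third follows from the equality of sums), and the map assigning to each curve parameter on the right
an equal one on the left. -/
theorem energy_three_curveSet_le {g : ZMod p} {L m : ℕ}
    (hg : Set.InjOn (fun n : ℕ => g ^ n) (Set.Iio (p - 1))) (hp : 120 * (L * m ^ 6) < p) :
    energy 3 (curveSet g L m) ≤ 27 * (L ^ 5 * m ^ 3) := by
  -- `s' z` rebuilds the right-hand triple; the truncated subtraction is exact on solutions.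
  let s' : ((Fin 3 → ℕ × ℕ) × (ℕ × ℕ)) × (Fin 3 → Fin 3) → Fin 3 → ℕ × ℕ := fun z =>
    ![(z.1.2.1, (z.1.1 (z.2 0)).2), (z.1.2.2, (z.1.1 (z.2 1)).2),
      (∑ j, (z.1.1 j).1 - z.1.2.1 - z.1.2.2, (z.1.1 (z.2 2)).2)]
  let G : ((Fin 3 → ℕ × ℕ) × (ℕ × ℕ)) × (Fin 3 → Fin 3) →
      (Fin 3 → ZMod p) × (Fin 3 → ZMod p) := fun z =>
    (fun j => g ^ curveCode L m (z.1.1 j), fun j => g ^ curveCode L m (s' z j))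
  let I := range L ×ˢ range m
  let Z := ((Fintype.piFinset fun _ : Fin 3 => I) ×ˢ (range L ×ˢ range L)) ×ˢ
    (univ : Finset (Fin 3 → Fin 3))
  have hsub : solutions 3 (curveSet g L m) ⊆ Z.image G := by
    intro t ht
    obtain ⟨⟨h1, h2⟩, e⟩ := mem_solutions.1 ht
    have h1 : ∀ j, ∃ v ∈ I, g ^ curveCode L m v = t.1 j := fun j => mem_image.1 (h1 j)
    have h2 : ∀ j, ∃ v ∈ I, g ^ curveCode L m v = t.2 j := fun j => mem_image.1 (h2 j)
    choose a ha hat using h1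
    choose b hb hbt using h2
    simp only [← hat, ← hbt, prod_pow_eq_pow_sum] at e
    have hlt : ∀ s : Fin 3 → ℕ × ℕ, (∀ j, s j ∈ I) →
        ∑ j, curveCode L m (s j) ∈ Set.Iio (p - 1) := by
      intro s hs
      have h0 := three_mul_curveCode_lt (hs 0)
      have h1 := three_mul_curveCode_lt (hs 1)
      have h2 := three_mul_curveCode_lt (hs 2)
      rw [Set.mem_Iio, Fin.sum_univ_three]
      omega
    obtain ⟨hsum, hk⟩ := sum_curveCode_eq ha hb (hg (hlt a ha) (hlt b hb) e)
    choose c hc using hk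
    refine mem_image.2 ⟨((a, ((b 0).1, (b 1).1)), c), ?_, ?_⟩
    · simp only [Z, mem_product, Fintype.mem_piFinset, mem_univ, and_true]
      exact ⟨ha, (mem_product.1 (hb 0)).1, (mem_product.1 (hb 1)).1⟩
    · have hs' : s' ((a, ((b 0).1, (b 1).1)), c) = b := by
        funext j
        simp only [s', ← hc, hsum]
        rw [Fin.sum_univ_three]
        have h2 : (b 0).1 + (b 1).1 + (b 2).1 - (b 0).1 - (b 1).1 = (b 2).1 := by omega
        rw [h2]
        fin_cases j <;> rfl
      refine Prod.ext (funext hat) (funext fun j => ?_)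
      change g ^ curveCode L m (s' ((a, ((b 0).1, (b 1).1)), c) j) = _
      rw [hs', hbt]
  calc energy 3 (curveSet g L m) ≤ (Z.image G).card := card_le_card hsub
    _ ≤ Z.card := card_image_le
    _ = 27 * (L ^ 5 * m ^ 3) := by
      simp [Z, I, card_product]
      ring

/-- There are at most `3L · m³` threefold products, since such a product depends only on the sum of
the interval parts and on the three curve parameters. -/
theorem le_energy_three_curveSet {g : ZMod p} {L m : ℕ}
    (hg : Set.InjOn (fun n : ℕ => g ^ n) (Set.Iio (p - 1))) (hp : 120 * (L * m ^ 6) < p)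
    (hL : L ≠ 0) (hm : m ≠ 0) :
    L ^ 5 * m ^ 3 ≤ 3 * energy 3 (curveSet g L m) := by
  have h := sq_card_pow_le_card_image_mul_energy 3 (curveSet g L m)
  let q : ℕ × (Fin 3 → ℕ) → ZMod p := fun z =>
    g ^ code L m z.1 (∑ j, z.2 j) (∑ j, z.2 j ^ 2) (∑ j, z.2 j ^ 3)
  have hsub : ((Fintype.piFinset fun _ : Fin 3 => curveSet g L m).image fun u => ∏ i, u i) ⊆
      (range (3 * L) ×ˢ (Fintype.piFinset fun _ : Fin 3 => range m)).image q := by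
    intro z hz
    obtain ⟨u, hu, rfl⟩ := mem_image.1 hz
    have hu : ∀ j, ∃ v ∈ range L ×ˢ range m, g ^ curveCode L m v = u j := fun j =>
      mem_image.1 (Fintype.mem_piFinset.1 hu j)
    choose s hs hsu using hu
    refine mem_image.2 ⟨(∑ j, (s j).1, fun j => (s j).2), ?_, ?_⟩
    · exact mem_product.2 ⟨mem_range.2 (sum_fst_lt hs),
        Fintype.mem_piFinset.2 fun j => (mem_product.1 (hs j)).2⟩
    · simp only [q, ← hsu, prod_pow_eq_pow_sum, sum_curveCode]
  have hcard := (card_le_card hsub).trans card_image_le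
  rw [card_product, card_range, Fintype.card_piFinset_const, card_range] at hcard
  rw [card_curveSet hg hp] at h
  have hpos : 0 < L * m ^ 3 := by positivity
  refine Nat.le_of_mul_le_mul_left ?_ hpos
  calc L * m ^ 3 * (L ^ 5 * m ^ 3) = ((L * m) ^ 3) ^ 2 := by ring
    _ ≤ _ := h
    _ ≤ 3 * L * m ^ 3 * energy 3 (curveSet g L m) := Nat.mul_le_mul_right _ hcard
    _ = _ := by ring

end

/-! ### Asymptotics -/

section

variable {p : ℕ}

/-- The lower bound for the ratio in terms of `E₃` alone. -/
theorem div_le_ratio [Fact p.Prime] {A : Finset (ZMod p)} (hA : (0 : ZMod p) ∉ A)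
    (hE : 0 < energy 3 A) : (energy 3 A : ℝ) / (A.card : ℝ) ^ 4 ≤ ratio A := by
  have hn : 0 < A.card := by
    rcases Nat.eq_zero_or_pos A.card with h | h
    · rw [card_eq_zero.1 h, ← card_solutions] at hE
      obtain ⟨t, ht⟩ := card_pos.1 hE
      exact absurd ((mem_solutions.1 ht).1.1 0) (notMem_empty _)
    · exact h
  have h : (energy 3 A : ℝ) ^ 2 ≤ (A.card : ℝ) ^ 3 * energy 4 A := by
    exact_mod_cast energy_three_sq_le hA
  have hn' : (0 : ℝ) < A.card := by exact_mod_cast hn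
  have hE' : (0 : ℝ) < energy 3 A := by exact_mod_cast hE
  rw [ratio, div_le_div_iff₀ (by positivity) (by positivity)]
  calc (energy 3 A : ℝ) * (A.card * energy 3 A) = A.card * (energy 3 A : ℝ) ^ 2 := by ring
    _ ≤ A.card * ((A.card : ℝ) ^ 3 * energy 4 A) := by gcongr
    _ = energy 4 A * (A.card : ℝ) ^ 4 := by ring

/-- Replacing `0` by a nonzero element outside `B` changes `E₃` by at most `9|B|⁴`. -/
theorem exists_notMem_energy_near [Fact p.Prime] (B : Finset (ZMod p)) (hB : (0 : ZMod p) ∈ B)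
    (hlt : B.card + 1 ≤ p) :
    ∃ A : Finset (ZMod p), 0 ∉ A ∧ A.card = B.card ∧
      energy 3 A ≤ energy 3 B + 9 * B.card ^ 4 ∧ energy 3 B ≤ energy 3 A + 9 * B.card ^ 4 := by
  obtain ⟨c, hc⟩ : ∃ c, c ∉ B := by
    by_contra! h
    have := card_eq_iff_eq_univ B |>.2 (eq_univ_iff_forall.2 h)
    rw [ZMod.card] at this
    omega
  have hS : (0 : ZMod p) ∉ B.erase 0 := notMem_erase _ _
  have hc0 : c ≠ 0 := fun h => hc (h ▸ hB)
  have hcS : c ∉ B.erase 0 := fun h => hc (mem_of_mem_erase h)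
  have hcard : (B.erase 0).card + 1 = B.card := card_erase_add_one hB
  have h0 := energy_three_insert_zero_le hS
  have h1 := energy_three_insert_le hS hc0 hcS
  rw [insert_erase hB] at h0
  rw [hcard] at h0 h1
  refine ⟨insert c (B.erase 0), ?_, ?_, ?_, ?_⟩
  · simp [hc0.symm]
  · rw [card_insert_of_notMem hcS, hcard]
  · have := energy_mono 3 (erase_subset 0 B)
    omega
  · have := energy_mono 3 (subset_insert c (B.erase 0))
    omega

theorem card_eq_rpow [Fact p.Prime] {B : Finset (ZMod p)} (h : 0 < eta B) :
    2 ≤ B.card ∧ (B.card : ℝ) = (p : ℝ) ^ eta B := by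
  have hp : (1 : ℝ) < p := by exact_mod_cast (Fact.out : p.Prime).one_lt
  have hlp := Real.log_pos hp
  have hB : 2 ≤ B.card := by
    by_contra hlt
    have : B.card = 0 ∨ B.card = 1 := by omega
    rcases this with h' | h' <;> simp [eta, h'] at h
  refine ⟨hB, ?_⟩
  have hB' : (0 : ℝ) < B.card := by exact_mod_cast (by omega : 0 < B.card)
  rw [Real.rpow_def_of_pos (by linarith), eta, mul_div_cancel₀ _ hlp.ne', Real.exp_log hB']

theorem energy_eq_rpow {B : Finset (ZMod p)} (hB : 2 ≤ B.card) (h : 0 < mu B) :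
    (energy 3 B : ℝ) = (B.card : ℝ) ^ mu B := by
  have hn : (1 : ℝ) < B.card := by exact_mod_cast hB
  have hln := Real.log_pos hn
  have hE : (0 : ℝ) < energy 3 B := by
    rcases Nat.eq_zero_or_pos (energy 3 B) with h' | h'
    · simp [mu, h'] at h
    · exact_mod_cast h'
  rw [Real.rpow_def_of_pos (by linarith), mu, mul_div_cancel₀ _ hln.ne', Real.exp_log hE]

theorem eventually_primesAtTop {q : ℕ → Prop} (h : ∀ᶠ p in atTop, p.Prime → q p) :
    ∀ᶠ p in primesAtTop, q p := by
  rw [primesAtTop, eventually_inf_principal]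
  exact h

theorem tendsto_natCast_rpow_atTop (x : ℝ) (hx : 0 < x) :
    Tendsto (fun p : ℕ => (p : ℝ) ^ x) atTop atTop :=
  (tendsto_rpow_atTop hx).comp tendsto_natCast_atTop_atTop

/-- The uniform assertion. The threshold on `p` enters through `|A| = p ^ x ≥ p ^ (1/3)`. -/
theorem eventually_exists_ratio_gt (M ε : ℝ) (hε : 0 < ε) :
    ∀ᶠ p : ℕ in primesAtTop, ∀ x y : ℝ, (x, y) ∈ U p →
      ∃ A : Finset (ZMod p), 0 ∉ A ∧ eta A = x ∧ |mu A - y| < ε ∧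
        ((x, y) ∈ HStar p → mu A = y) ∧ M < ratio A := by
  have hev : ∀ᶠ t : ℝ in atTop, 18 ≤ t ^ (1 / 2 : ℝ) ∧ 2 * M < t ^ (1 / 2 : ℝ) ∧
      Real.log 2 / ε < Real.log t := by
    have h := tendsto_rpow_atTop (y := (1 / 2 : ℝ)) (by norm_num)
    exact (h.eventually_ge_atTop 18).and ((h.eventually_gt_atTop _).and
      (Real.tendsto_log_atTop.eventually_gt_atTop _))
  obtain ⟨N, hN⟩ := eventually_atTop.1 hev
  refine eventually_primesAtTop ?_
  filter_upwards [(tendsto_natCast_rpow_atTop (1 / 3) (by norm_num)).eventually_ge_atTop N] with p hpN hp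
  have : Fact p.Prime := ⟨hp⟩
  have hp1 : (1 : ℝ) < p := by exact_mod_cast hp.one_lt
  have key : ∀ B : Finset (ZMod p), 1 / 3 < eta B → 113 / 24 < mu B →
      2 ≤ B.card ∧ 18 ≤ (B.card : ℝ) ^ (1 / 2 : ℝ) ∧ 2 * M < (B.card : ℝ) ^ (1 / 2 : ℝ) ∧
      Real.log 2 / ε < Real.log B.card ∧
      (B.card : ℝ) ^ (1 / 2 : ℝ) * (B.card : ℝ) ^ 4 ≤ energy 3 B := by
    intro B hx hy
    obtain ⟨h2, hcard⟩ := card_eq_rpow (B := B) (by linarith)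
    have hNB : N ≤ (B.card : ℝ) := by
      rw [hcard]
      exact hpN.trans (Real.rpow_le_rpow_of_exponent_le hp1.le hx.le)
    obtain ⟨ha, hb, hc⟩ := hN _ hNB
    refine ⟨h2, ha, hb, hc, ?_⟩
    have hn : (1 : ℝ) < B.card := by exact_mod_cast h2
    rw [energy_eq_rpow h2 (by linarith), ← Real.rpow_natCast, ← Real.rpow_add (by linarith)]
    exact Real.rpow_le_rpow_of_exponent_le hn.le (by norm_num; linarith)
  have ratio_gt : ∀ A : Finset (ZMod p), 0 ∉ A → 2 ≤ A.card →
      18 ≤ (A.card : ℝ) ^ (1 / 2 : ℝ) → 2 * M < (A.card : ℝ) ^ (1 / 2 : ℝ) →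
      (A.card : ℝ) ^ (1 / 2 : ℝ) * (A.card : ℝ) ^ 4 ≤ 2 * energy 3 A → M < ratio A := by
    intro A hA h2 h18 hM hE
    have hn : (0 : ℝ) < (A.card : ℝ) ^ 4 := by
      have : 0 < A.card := by omega
      positivity
    have hE0 : (0 : ℝ) < energy 3 A := by nlinarith
    refine lt_of_lt_of_le ?_ (div_le_ratio hA (by exact_mod_cast hE0))
    rw [lt_div_iff₀ hn]
    nlinarith
  rintro x y ⟨⟨hx, hx', hy, hy'⟩, B, hB⟩
  -- A representative avoiding `0` is preferred, since then `μ(A) = y` is required exactly.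
  by_cases hstar : (x, y) ∈ HStar p
  · obtain ⟨A, hA, hAxy⟩ := hstar
    obtain ⟨rfl, rfl⟩ := Prod.mk.inj hAxy
    obtain ⟨h2, h18, hM, -, hE⟩ := key A hx hy
    have hEnn : (0 : ℝ) ≤ energy 3 A := Nat.cast_nonneg _
    exact ⟨A, hA, rfl, by simpa using hε, fun _ => rfl, ratio_gt A hA h2 h18 hM (by linarith)⟩
  obtain ⟨rfl, rfl⟩ := Prod.mk.inj hB
  have hB0 : (0 : ZMod p) ∈ B := by
    by_contra h0
    exact hstar ⟨B, h0, rfl⟩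
  obtain ⟨h2, h18, hM, hlog, hE⟩ := key B hx hy
  have hlt : B.card + 1 ≤ p := by
    have : (B.card : ℝ) < p := by
      rw [(card_eq_rpow (B := B) (by linarith)).2]
      calc (p : ℝ) ^ eta B < (p : ℝ) ^ (1 : ℝ) :=
            Real.rpow_lt_rpow_of_exponent_lt hp1 (by linarith)
        _ = p := Real.rpow_one _
    exact_mod_cast this
  obtain ⟨A, hA, hcard, hup, hlow⟩ := exists_notMem_energy_near B hB0 hlt
  have hup' : (energy 3 A : ℝ) ≤ energy 3 B + 9 * (B.card : ℝ) ^ 4 := by exact_mod_cast hup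
  have hlow' : (energy 3 B : ℝ) ≤ energy 3 A + 9 * (B.card : ℝ) ^ 4 := by exact_mod_cast hlow
  have hn : (0 : ℝ) < (B.card : ℝ) ^ 4 := by
    have : 0 < B.card := by omega
    positivity
  have h9 : 18 * (B.card : ℝ) ^ 4 ≤ energy 3 B :=
    (mul_le_mul_of_nonneg_right h18 hn.le).trans hE
  have hlow2 : (energy 3 B : ℝ) ≤ 2 * energy 3 A := by linarith
  have hup2 : (energy 3 A : ℝ) ≤ 2 * energy 3 B := by linarith
  have hEB : (0 : ℝ) < energy 3 B := by linarith
  have hEA : (0 : ℝ) < energy 3 A := by linarith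
  have hlogB : 0 < Real.log B.card := Real.log_pos (by exact_mod_cast h2)
  refine ⟨A, hA, by rw [eta, hcard, eta], ?_, fun h => absurd h hstar, ?_⟩
  · have h1 := Real.log_le_log hEB hlow2
    have h2 := Real.log_le_log hEA hup2
    rw [Real.log_mul two_ne_zero hEA.ne'] at h1
    rw [Real.log_mul two_ne_zero hEB.ne'] at h2
    rw [mu, mu, hcard, ← sub_div, abs_div, abs_of_pos hlogB, div_lt_iff₀ hlogB]
    rw [div_lt_iff₀ hε] at hlog
    exact (abs_le.2 ⟨by linarith, by linarith⟩ : _ ≤ Real.log 2).trans_lt (by linarith)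
  · exact ratio_gt A hA (hcard ▸ h2) (hcard ▸ h18) (hcard ▸ hM) (by rw [hcard]; linarith)

theorem tendsto_log_floor_div_log {a : ℝ} (ha : 0 < a) :
    Tendsto (fun p : ℕ => Real.log (⌊(p : ℝ) ^ a⌋₊ : ℕ) / Real.log p) atTop (𝓝 a) := by
  have hlog : Tendsto (fun p : ℕ => Real.log p) atTop atTop :=
    Real.tendsto_log_atTop.comp tendsto_natCast_atTop_atTop
  have h1 : Tendsto (fun p : ℕ => a - Real.log 2 / Real.log p) atTop (𝓝 a) := by
    simpa using (tendsto_const_nhds (x := a)).sub (hlog.const_div_atTop (Real.log 2))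
  refine tendsto_of_tendsto_of_tendsto_of_le_of_le' h1 tendsto_const_nhds ?_ ?_
  all_goals
    filter_upwards [eventually_gt_atTop 1, (tendsto_natCast_rpow_atTop a ha).eventually_ge_atTop 1]
      with p hp h
    have hp' : (1 : ℝ) < p := by exact_mod_cast hp
    have hl : 0 < Real.log p := Real.log_pos hp'
    have hf : 1 ≤ ⌊(p : ℝ) ^ a⌋₊ := Nat.one_le_floor_iff _ |>.2 h
    have hf' : (1 : ℝ) ≤ ⌊(p : ℝ) ^ a⌋₊ := by exact_mod_cast hf
  · have : (p : ℝ) ^ a ≤ 2 * ⌊(p : ℝ) ^ a⌋₊ := by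
      have := Nat.lt_floor_add_one ((p : ℝ) ^ a)
      linarith
    have := Real.log_le_log (by positivity) this
    rw [Real.log_rpow (by linarith), Real.log_mul two_ne_zero (by positivity)] at this
    rw [le_div_iff₀ hl, sub_mul, div_mul_cancel₀ _ hl.ne']
    linarith
  · have := Real.log_le_log (by positivity) (Nat.floor_le (by positivity : 0 ≤ (p : ℝ) ^ a))
    rw [Real.log_rpow (by linarith)] at this
    rwa [div_le_iff₀ hl]

/-- The sets `curveSet g L m` with `L` and `m` suitable powers of `p` approach any point of the
rectangle. -/
theorem exists_tendsto (x y : ℝ) (hxy : (x, y) ∈ rect) :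
    ∃ A : (p : ℕ) → Finset (ZMod p),
      (∀ p : ℕ, p.Prime → 0 ∉ A p) ∧
      Tendsto (fun p => eta (A p)) primesAtTop (𝓝 x) ∧
      Tendsto (fun p => mu (A p)) primesAtTop (𝓝 y) ∧
      Tendsto (fun p => ratio (A p)) primesAtTop atTop := by
  obtain ⟨hx, hx', hy, hy'⟩ := hxy
  simp only at hx hx' hy hy'
  set b : ℝ := (5 - y) / 2 with hb
  have hxb : 0 < x * b := mul_pos (by linarith) (by linarith)
  have hxa : 0 < x * (1 - b) := mul_pos (by linarith) (by linarith)
  let L : ℕ → ℕ := fun p => ⌊(p : ℝ) ^ (x * (1 - b))⌋₊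
  let m : ℕ → ℕ := fun p => ⌊(p : ℝ) ^ (x * b)⌋₊
  have hle : primesAtTop ≤ atTop := inf_le_left
  have hprime : ∀ᶠ p : ℕ in primesAtTop, p.Prime :=
    eventually_primesAtTop (Eventually.of_forall fun _ h => h)
  have hg : ∀ p : ℕ, ∃ g : ZMod p, p.Prime →
      g ≠ 0 ∧ Set.InjOn (fun n : ℕ => g ^ n) (Set.Iio (p - 1)) := by
    intro p
    by_cases hp : p.Prime
    · have : Fact p.Prime := ⟨hp⟩
      obtain ⟨g, h⟩ := exists_injOn_pow (p := p)
      exact ⟨g, fun _ => h⟩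
    · exact ⟨0, fun h => absurd h hp⟩
  choose g hg using hg
  have hL : ∀ᶠ p : ℕ in atTop, L p ≠ 0 := by
    filter_upwards [(tendsto_natCast_rpow_atTop _ hxa).eventually_ge_atTop 1] with p h
    have : 1 ≤ L p := Nat.one_le_floor_iff _ |>.2 h
    omega
  have hm : ∀ᶠ p : ℕ in atTop, m p ≠ 0 := by
    filter_upwards [(tendsto_natCast_rpow_atTop _ hxb).eventually_ge_atTop 1] with p h
    have : 1 ≤ m p := Nat.one_le_floor_iff _ |>.2 h
    omega
  have hsize : ∀ᶠ p : ℕ in atTop, 120 * (L p * m p ^ 6) < p := by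
    have hc : 0 < 1 - (x * (1 - b) + x * b * (6 : ℕ)) := by
      push_cast
      nlinarith
    filter_upwards [(tendsto_natCast_rpow_atTop _ hc).eventually_gt_atTop 120, eventually_gt_atTop 1]
      with p h hp
    have hp0 : (0 : ℝ) < p := by exact_mod_cast (by omega : 0 < p)
    have h1 : (L p : ℝ) ≤ (p : ℝ) ^ (x * (1 - b)) := Nat.floor_le (by positivity)
    have h2 : (m p : ℝ) ≤ (p : ℝ) ^ (x * b) := Nat.floor_le (by positivity)
    have : (120 : ℝ) * (L p * (m p : ℝ) ^ 6) < p := calc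
      (120 : ℝ) * (L p * (m p : ℝ) ^ 6)
          ≤ 120 * ((p : ℝ) ^ (x * (1 - b)) * ((p : ℝ) ^ (x * b)) ^ 6) := by gcongr
      _ = 120 * (p : ℝ) ^ (x * (1 - b) + x * b * (6 : ℕ)) := by
        rw [Real.rpow_add hp0, Real.rpow_mul_natCast hp0.le]
      _ < (p : ℝ) ^ (1 - (x * (1 - b) + x * b * (6 : ℕ))) *
          (p : ℝ) ^ (x * (1 - b) + x * b * (6 : ℕ)) := by gcongr
      _ = p := by rw [← Real.rpow_add hp0, sub_add_cancel, Real.rpow_one]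
    exact_mod_cast this
  let A : (p : ℕ) → Finset (ZMod p) := fun p => curveSet (g p) (L p) (m p)
  have hall : ∀ᶠ p : ℕ in primesAtTop, p.Prime ∧ 1 < p ∧ L p ≠ 0 ∧ m p ≠ 0 ∧ 0 ∉ A p ∧
      (A p).card = L p * m p ∧ energy 3 (A p) ≤ 27 * (L p ^ 5 * m p ^ 3) ∧
      L p ^ 5 * m p ^ 3 ≤ 3 * energy 3 (A p) := by
    filter_upwards [hprime, hle hL, hle hm, hle hsize] with p hp h1 h2 h3
    have : Fact p.Prime := ⟨hp⟩
    obtain ⟨hg0, hgi⟩ := hg p hp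
    exact ⟨hp, hp.one_lt, h1, h2, zero_notMem_curveSet hg0 _ _, card_curveSet hgi h3,
      energy_three_curveSet_le hgi h3, le_energy_three_curveSet hgi h3 h1 h2⟩
  have hlL := (tendsto_log_floor_div_log hxa).mono_left hle
  have hlm := (tendsto_log_floor_div_log hxb).mono_left hle
  have hlog : Tendsto (fun p : ℕ => Real.log p) primesAtTop atTop :=
    (Real.tendsto_log_atTop.comp tendsto_natCast_atTop_atTop).mono_left hle
  have heta : Tendsto (fun p => eta (A p)) primesAtTop (𝓝 x) := by
    have h := hlL.add hlm
    rw [show x * (1 - b) + x * b = x by ring] at h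
    refine h.congr' ?_
    filter_upwards [hall] with p ⟨_, _, h1, h2, _, hc, _⟩
    rw [eta, hc, Nat.cast_mul, Real.log_mul (by exact_mod_cast h1) (by exact_mod_cast h2), add_div]
  have hlogE : Tendsto (fun p => Real.log (energy 3 (A p)) / Real.log p) primesAtTop
      (𝓝 (x * y)) := by
    have h := (hlL.const_mul 5).add (hlm.const_mul 3)
    rw [show 5 * (x * (1 - b)) + 3 * (x * b) = x * y by rw [hb]; ring] at h
    have hlow := h.sub (hlog.const_div_atTop (Real.log 3))
    have hup := h.add (hlog.const_div_atTop (Real.log 27))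
    rw [sub_zero] at hlow
    rw [add_zero] at hup
    refine tendsto_of_tendsto_of_tendsto_of_le_of_le' hlow hup ?_ ?_
    all_goals
      filter_upwards [hall] with p ⟨_, hp1, h1, h2, _, _, hu, hl⟩
      have hlp : 0 < Real.log p := Real.log_pos (by exact_mod_cast hp1)
      have hL0 : (0 : ℝ) < L p := by exact_mod_cast Nat.pos_of_ne_zero h1
      have hm0 : (0 : ℝ) < m p := by exact_mod_cast Nat.pos_of_ne_zero h2
      have hu' : (energy 3 (A p) : ℝ) ≤ 27 * ((L p : ℝ) ^ 5 * (m p : ℝ) ^ 3) := by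
        exact_mod_cast hu
      have hl' : (L p : ℝ) ^ 5 * (m p : ℝ) ^ 3 ≤ 3 * energy 3 (A p) := by exact_mod_cast hl
      have hpos : 0 < (L p : ℝ) ^ 5 * (m p : ℝ) ^ 3 := by positivity
      have hE : (0 : ℝ) < energy 3 (A p) := by linarith
      have hlogLm : Real.log ((L p : ℝ) ^ 5 * (m p : ℝ) ^ 3) =
          5 * Real.log (L p) + 3 * Real.log (m p) := by
        rw [Real.log_mul (by positivity) (by positivity), Real.log_pow, Real.log_pow]
        norm_num
    · have := Real.log_le_log hpos hl'
      rw [Real.log_mul (by norm_num) hE.ne', hlogLm] at this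
      rw [← mul_div_assoc, ← mul_div_assoc, ← add_div, ← sub_div]
      exact div_le_div_of_nonneg_right (by linarith) hlp.le
    · have := Real.log_le_log hE hu'
      rw [Real.log_mul (by norm_num) hpos.ne', hlogLm] at this
      rw [← mul_div_assoc, ← mul_div_assoc, ← add_div, ← add_div]
      exact div_le_div_of_nonneg_right (by linarith) hlp.le
  refine ⟨A, fun p hp => ?_, heta, ?_, ?_⟩
  · have : Fact p.Prime := ⟨hp⟩
    exact zero_notMem_curveSet (hg p hp).1 _ _
  · have h := hlogE.div heta (by linarith)
    rw [mul_div_cancel_left₀ _ (by linarith : x ≠ 0)] at h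
    refine h.congr' ?_
    filter_upwards [hall] with p ⟨_, hp1, _⟩
    have hlp : 0 < Real.log p := Real.log_pos (by exact_mod_cast hp1)
    simp only [Pi.div_apply, eta, mu]
    exact div_div_div_cancel_right₀ hlp.ne' _ _
  · have h := hlogE.sub (heta.const_mul 4)
    rw [show x * y - 4 * x = x * (y - 4) by ring] at h
    have h' := Real.tendsto_exp_atTop.comp
      (hlog.atTop_mul_pos (mul_pos (by linarith) (by linarith) : 0 < x * (y - 4)) h)
    refine tendsto_atTop_mono' _ ?_ h'
    filter_upwards [hall] with p ⟨hp, hp1, h1, h2, h0, hc, _, hl⟩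
    have : Fact p.Prime := ⟨hp⟩
    have hlp : 0 < Real.log p := Real.log_pos (by exact_mod_cast hp1)
    have hpos : 0 < L p ^ 5 * m p ^ 3 := by positivity
    have hE : 0 < energy 3 (A p) := by omega
    have hA : 0 < (A p).card := by rw [hc]; positivity
    refine le_trans (le_of_eq ?_) (div_le_ratio h0 hE)
    have hE' : (0 : ℝ) < energy 3 (A p) := by exact_mod_cast hE
    have hA' : (0 : ℝ) < (A p).card := by exact_mod_cast hA
    simp only [Function.comp, eta]
    rw [mul_sub, mul_div_cancel₀ _ hlp.ne', mul_left_comm, mul_div_cancel₀ _ hlp.ne',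
      Real.exp_sub, Real.exp_log hE', ← Real.exp_log (pow_pos hA' 4), Real.log_pow]
    norm_num

end

end EnergyDist

theorem theorem2p1 :
    (∀ M ε : ℝ, 0 < ε → ∀ᶠ p : ℕ in EnergyDist.primesAtTop,
      ∀ x y : ℝ, (x, y) ∈ EnergyDist.U p →
        ∃ A : Finset (ZMod p), 0 ∉ A ∧
          EnergyDist.eta A = x ∧
          |EnergyDist.mu A - y| < ε ∧
          ((x, y) ∈ EnergyDist.HStar p → EnergyDist.mu A = y) ∧
          M < EnergyDist.ratio A) ∧
    (∀ x y : ℝ, (x, y) ∈ EnergyDist.rect →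
      ∃ A : (p : ℕ) → Finset (ZMod p),
        (∀ p : ℕ, p.Prime → 0 ∉ A p) ∧
        Filter.Tendsto (fun p => EnergyDist.eta (A p)) EnergyDist.primesAtTop (nhds x) ∧
        Filter.Tendsto (fun p => EnergyDist.mu (A p)) EnergyDist.primesAtTop (nhds y) ∧
        Filter.Tendsto (fun p => EnergyDist.ratio (A p)) EnergyDist.primesAtTop Filter.atTop) := by
  exact ⟨EnergyDist.eventually_exists_ratio_gt, EnergyDist.exists_tendsto⟩
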